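/- Graphs and multigraphs are finite; a multigraph may have loops and parallel edges, and a loop contributes 2 to the degree of its vertex. A (multi)graph is planar if it can be drawn in the plane so that its edges do not cross, meeting only at vertices. Let $H$ be a simple planar graph with maximum degree $\Delta(H) \le 4$. Then there exists a $4$-regular simple planar graph $G$ with $H \subset G$ (where $G$ may have additional vertices) if and only if there exists a $4$-regular planar multigraph $G'$ with $H \subset G'$ and $V(G') = V(H)$. -/

import Mathlib

universe u

namespace Graph

/-- A drawing of the multigraph `G` in the plane without crossings. The vertex `v` is drawn as the
point `p v`, and the edge `e` as the curve `γ e`, parametrised by the interval from `0` to `1`. -/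
structure IsPlaneDrawing {α β : Type*} (G : Graph α β) (p : α → EuclideanSpace ℝ (Fin 2))
    (γ : β → ℝ → EuclideanSpace ℝ (Fin 2)) : Prop where
  /-- Distinct vertices are distinct points. -/
  injOn_point : Set.InjOn p G.vertexSet
  /-- Edges are continuous curves. -/
  continuousOn : ∀ e ∈ G.edgeSet, ContinuousOn (γ e) (Set.Icc 0 1)
  /-- The curve of an edge joins the ends of the edge (for a loop it is closed). -/
  ends : ∀ e ∈ G.edgeSet, ∃ u v, G.IsLink e u v ∧ γ e 0 = p u ∧ γ e 1 = p v
  /-- The interior of an edge does not cross itself. -/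
  injOn_curve : ∀ e ∈ G.edgeSet, Set.InjOn (γ e) (Set.Ioo 0 1)
  /-- The interior of an edge contains no vertex. -/
  avoids_vertices : ∀ e ∈ G.edgeSet, ∀ t ∈ Set.Ioo (0 : ℝ) 1, ∀ v ∈ G.vertexSet, γ e t ≠ p v
  /-- The interiors of distinct edges (also of parallel ones) are disjoint. -/
  avoids_edges : ∀ e ∈ G.edgeSet, ∀ f ∈ G.edgeSet, e ≠ f →
    ∀ s ∈ Set.Ioo (0 : ℝ) 1, ∀ t ∈ Set.Ioo (0 : ℝ) 1, γ e s ≠ γ f t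

/-- A multigraph is planar if it can be drawn in the plane so that its edges do not cross,
meeting only at vertices. -/
def IsPlanar {α β : Type*} (G : Graph α β) : Prop :=
  ∃ (p : α → EuclideanSpace ℝ (Fin 2)) (γ : β → ℝ → EuclideanSpace ℝ (Fin 2)),
    G.IsPlaneDrawing p γ

/-- The degree of a vertex of a multigraph: the number of edges at it, each loop counted twice. -/
noncomputable def degree {α β : Type*} (G : Graph α β) (v : α) : ℕ∞ :=
  (G.incidenceSet v).encard + (G.loopSet v).encard

/-- Every vertex of the multigraph has degree `d`. -/
def IsRegularOfDegree {α β : Type*} (G : Graph α β) (d : ℕ) : Prop :=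
  ∀ v ∈ G.vertexSet, G.degree v = d

end Graph

/-- A simple graph is planar if it is so as a multigraph. -/
def SimpleGraph.IsPlanar {V : Type*} (G : SimpleGraph V) : Prop :=
  (Graph.ofSimpleGraph G).IsPlanar

/-!
Both directions are local surgery on a drawing inside small discs. A drawing is recorded as a set of
points together with a list of arcs, each arc being a pair of ends and the set of its interior
points (`Arc`, `IsDrawing`); surgery then means taking some arcs off the list and putting others on,
and degrees are sums over the list.

An arbitrary curve need not be tame near its start, but it leaves every small disc about its start
for a last time (`IsCurve.exists_exit`), and what comes after that lies outside the disc. So inside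
the disc the drawing may be redrawn with straight segments, and no form of the Jordan curve theorem
is needed.

* From a simple graph to a multigraph: the vertices outside the given graph are removed one by one
  (`IsDrawing.remove_vertex`). Loops at such a vertex are deleted. If four other arcs leave it, they
  are cut where they leave a small disc for the last time; of four points on a circle some two pairs
  have disjoint chords (`disjoint_chords`), and these chords join the arcs in pairs. If two arcs
  leave it, they are joined at the vertex itself. Degrees of other vertices and edges between other
  vertices are unchanged.
* From a multigraph to a simple graph: of each class of parallel edges one is kept
  (`exists_perm_isSimple`). Every other edge, loops included, is cut at a small disc about one of
  its interior points, and an octahedron without an edge `ab` is drawn by straight segments in the disc,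
  with `a` and `b` the two points on the circle (`IsDrawing.replace_by_gadget`). All new vertices
  have degree four, old degrees are unchanged, and no new edge is a loop or parallel to another edge.
-/

namespace PlaneDrawing

/-! ### Curves -/

/-- The set `I` is the interior of a curve from `x` to `y`: a continuous curve parametrised by
`[0, 1]` which is injective on `(0, 1)`. The curve may be closed. It is asked to be defined and
continuous on all of `ℝ`, which is no restriction and spares `ContinuousOn` bookkeeping. -/
def IsCurve {X : Type*} [TopologicalSpace X] (x y : X) (I : Set X) : Prop :=
  ∃ γ : ℝ → X, Continuous γ ∧ γ 0 = x ∧ γ 1 = y ∧ Set.InjOn γ (Set.Ioo 0 1) ∧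
    γ '' Set.Ioo 0 1 = I

namespace IsCurve

section Topology

variable {X : Type*} [TopologicalSpace X] {x y z : X} {I J : Set X}

lemma of_continuousOn {γ : ℝ → X} (hγ : ContinuousOn γ (Set.Icc 0 1))
    (hinj : Set.InjOn γ (Set.Ioo 0 1)) : IsCurve (γ 0) (γ 1) (γ '' Set.Ioo 0 1) := by
  have h01 : (0 : ℝ) ≤ 1 := zero_le_one
  have key : ∀ t ∈ Set.Icc (0 : ℝ) 1,
      Set.IccExtend h01 ((Set.Icc (0 : ℝ) 1).domRestrict γ) t = γ t := fun t ht ↦ by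
    rw [Set.IccExtend_of_mem _ _ ht]; rfl
  have key' : Set.EqOn (Set.IccExtend h01 ((Set.Icc (0 : ℝ) 1).domRestrict γ)) γ (Set.Ioo 0 1) :=
    fun t ht ↦ key t (Set.Ioo_subset_Icc_self ht)
  exact ⟨_, (continuousOn_iff_continuous_domRestrict.1 hγ).Icc_extend', key 0 (by simp),
    key 1 (by simp), hinj.congr key'.symm, key'.image_eq⟩

lemma symm (h : IsCurve x y I) : IsCurve y x I := by
  obtain ⟨γ, hγ, rfl, rfl, hinj, rfl⟩ := h
  refine ⟨fun t ↦ γ (1 - t), by fun_prop, by simp, by simp, ?_, ?_⟩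
  · intro s hs t ht hst
    have := hinj (x₁ := 1 - s) (x₂ := 1 - t) ⟨by linarith [hs.2], by linarith [hs.1]⟩
      ⟨by linarith [ht.2], by linarith [ht.1]⟩ hst
    linarith
  · have := Set.image_image γ (fun t : ℝ ↦ 1 - t) (Set.Ioo 0 1)
    rw [← this]
    simp

/-- The part of a curve between two parameters is a curve. -/
lemma of_subinterval {γ : ℝ → X} (hγ : Continuous γ) {a b : ℝ} (hab : a < b)
    (hinj : Set.InjOn γ (Set.Ioo a b)) : IsCurve (γ a) (γ b) (γ '' Set.Ioo a b) := by
  have him : (fun t : ℝ ↦ (b - a) * t + a) '' Set.Ioo 0 1 = Set.Ioo a b := by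
    rw [Set.image_affine_Ioo (sub_pos.2 hab)]
    simp
  refine ⟨fun t ↦ γ ((b - a) * t + a), by fun_prop, by simp, by simp, ?_, ?_⟩
  · intro s hs t ht hst
    have := hinj (him ▸ Set.mem_image_of_mem _ hs) (him ▸ Set.mem_image_of_mem _ ht) hst
    have h2 : (b - a) * s = (b - a) * t := by simpa using this
    exact mul_left_cancel₀ (sub_pos.2 hab).ne' h2
  · rw [← him, Set.image_image]

lemma trans (h : IsCurve x y I) (h' : IsCurve y z J) (hIJ : Disjoint I J) (hI : y ∉ I)
    (hJ : y ∉ J) : IsCurve x z (I ∪ {y} ∪ J) := by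
  obtain ⟨γ, hγ, rfl, rfl, hinj, rfl⟩ := h
  obtain ⟨δ, hδ, h0, rfl, hinj', rfl⟩ := h'
  set f : ℝ → X := fun t ↦ if t ≤ 1 / 2 then γ (2 * t) else δ (2 * t - 1) with hf
  have f1 : ∀ t ∈ Set.Ioo (0 : ℝ) (1 / 2), f t = γ (2 * t) := fun t ht ↦ by
    simp only [hf]; rw [if_pos ht.2.le]
  have f2 : ∀ t ∈ Set.Ioo (1 / 2 : ℝ) 1, f t = δ (2 * t - 1) := fun t ht ↦ by
    simp only [hf]; rw [if_neg (not_le.2 ht.1)]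
  have f3 : f (1 / 2) = γ 1 := by simp [hf]
  have m1 : ∀ t ∈ Set.Ioo (0 : ℝ) (1 / 2), 2 * t ∈ Set.Ioo (0 : ℝ) 1 := fun t ht ↦
    ⟨by linarith [ht.1], by linarith [ht.2]⟩
  have m2 : ∀ t ∈ Set.Ioo (1 / 2 : ℝ) 1, 2 * t - 1 ∈ Set.Ioo (0 : ℝ) 1 := fun t ht ↦
    ⟨by linarith [ht.1], by linarith [ht.2]⟩
  have hcases : ∀ t ∈ Set.Ioo (0 : ℝ) 1,
      t ∈ Set.Ioo (0 : ℝ) (1 / 2) ∨ t = 1 / 2 ∨ t ∈ Set.Ioo (1 / 2 : ℝ) 1 := fun t ht ↦ by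
    rcases lt_trichotomy t (1 / 2) with h | h | h
    · exact Or.inl ⟨ht.1, h⟩
    · exact Or.inr (Or.inl h)
    · exact Or.inr (Or.inr ⟨h, ht.2⟩)
  have hne : ∀ s ∈ Set.Ioo (0 : ℝ) 1, ∀ t ∈ Set.Ioo (0 : ℝ) 1, γ s ≠ δ t := fun s hs t ht e ↦
    Set.disjoint_left.1 hIJ ⟨s, hs, rfl⟩ ⟨t, ht, e.symm⟩
  refine ⟨f, ?_, ?_, ?_, ?_, ?_⟩
  · refine Continuous.if_le (by fun_prop) (by fun_prop) continuous_id continuous_const ?_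
    rintro t rfl
    norm_num [h0]
  · simp [hf]
  · norm_num [hf]
  · intro s hs t ht hst
    rcases hcases s hs with h | h | h <;> rcases hcases t ht with k | k | k
    · rw [f1 _ h, f1 _ k] at hst
      linarith [hinj (m1 _ h) (m1 _ k) hst]
    · rw [f1 _ h, k, f3] at hst
      exact (hI ⟨_, m1 _ h, hst⟩).elim
    · rw [f1 _ h, f2 _ k] at hst
      exact (hne _ (m1 _ h) _ (m2 _ k) hst).elim
    · rw [f1 _ k, h, f3] at hst
      exact (hI ⟨_, m1 _ k, hst.symm⟩).elim
    · rw [h, k]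
    · rw [f2 _ k, h, f3] at hst
      exact (hJ ⟨_, m2 _ k, hst.symm⟩).elim
    · rw [f1 _ k, f2 _ h] at hst
      exact (hne _ (m1 _ k) _ (m2 _ h) hst.symm).elim
    · rw [f2 _ h, k, f3] at hst
      exact (hJ ⟨_, m2 _ h, hst⟩).elim
    · rw [f2 _ h, f2 _ k] at hst
      linarith [hinj' (m2 _ h) (m2 _ k) hst]
  · ext z
    constructor
    · rintro ⟨t, ht, rfl⟩
      rcases hcases t ht with h | h | h
      · rw [f1 _ h]; exact Or.inl (Or.inl ⟨_, m1 _ h, rfl⟩)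
      · rw [h, f3]; exact Or.inl (Or.inr rfl)
      · rw [f2 _ h]; exact Or.inr ⟨_, m2 _ h, rfl⟩
    · rintro ((⟨t, ht, rfl⟩ | rfl) | ⟨t, ht, rfl⟩)
      · have : t / 2 ∈ Set.Ioo (0 : ℝ) (1 / 2) := ⟨by linarith [ht.1], by linarith [ht.2]⟩
        exact ⟨t / 2, ⟨this.1, by linarith [this.2]⟩, by rw [f1 _ this]; congr 1; ring⟩
      · exact ⟨1 / 2, by norm_num, f3⟩
      · have : (t + 1) / 2 ∈ Set.Ioo (1 / 2 : ℝ) 1 := ⟨by linarith [ht.1], by linarith [ht.2]⟩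
        exact ⟨(t + 1) / 2, ⟨by linarith [this.1], this.2⟩, by rw [f2 _ this]; congr 1; ring⟩

lemma nonempty (h : IsCurve x y I) : I.Nonempty := by
  obtain ⟨γ, -, -, -, -, rfl⟩ := h
  exact ⟨γ (1 / 2), 1 / 2, by norm_num, rfl⟩

/-- A curve together with its ends is compact. -/
lemma isCompact (h : IsCurve x y I) : IsCompact (insert x (insert y I)) := by
  obtain ⟨γ, hγ, rfl, rfl, hinj, rfl⟩ := h
  have : insert (γ 0) (insert (γ 1) (γ '' Set.Ioo 0 1)) = γ '' Set.Icc 0 1 := by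
    rw [← Set.image_insert_eq, ← Set.image_insert_eq, Set.Ioo_insert_right zero_lt_one,
      Set.Ioc_insert_left zero_le_one]
  rw [this]
  exact isCompact_Icc.image hγ

/-- A point in the interior of a curve cuts it into two curves. -/
lemma exists_split (h : IsCurve x y I) {q : X} (hq : q ∈ I) :
    ∃ J K, IsCurve x q J ∧ IsCurve q y K ∧ J ⊆ I ∧ K ⊆ I ∧ Disjoint J K := by
  obtain ⟨γ, hγ, rfl, rfl, hinj, rfl⟩ := h
  obtain ⟨s, hs, rfl⟩ := hq
  have h1 : Set.Ioo 0 s ⊆ Set.Ioo 0 1 := Set.Ioo_subset_Ioo_right hs.2.le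
  have h2 : Set.Ioo s 1 ⊆ Set.Ioo 0 1 := Set.Ioo_subset_Ioo_left hs.1.le
  refine ⟨_, _, of_subinterval hγ hs.1 (hinj.mono h1), of_subinterval hγ hs.2 (hinj.mono h2),
    Set.image_mono h1, Set.image_mono h2, ?_⟩
  rw [Set.disjoint_left]
  rintro _ ⟨t, ht, rfl⟩ ⟨t', ht', e⟩
  have := hinj (h2 ht') (h1 ht) e
  linarith [ht.2, ht'.1]

end Topology

/-- A curve that starts at the centre of a disc and ends outside leaves the disc for the last time
at a point of the bounding circle; from there on it is a curve outside the disc. -/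
lemma exists_exit {X : Type*} [PseudoMetricSpace X] {x y : X} {I : Set X} (h : IsCurve x y I)
    {r : ℝ} (hr : 0 < r) (hy : y ∉ Metric.closedBall x r) :
    ∃ a ∈ Metric.sphere x r, a ∈ I ∧ ∃ J ⊆ I, IsCurve a y J ∧
      Disjoint J (Metric.closedBall x r) := by
  obtain ⟨γ, hγ, rfl, rfl, hinj, rfl⟩ := h
  have hcpt : IsCompact (Set.Icc (0 : ℝ) 1 ∩ γ ⁻¹' Metric.closedBall (γ 0) r) :=
    isCompact_Icc.inter_right (Metric.isClosed_closedBall.preimage hγ)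
  obtain ⟨s, ⟨hs, hsD⟩, hmax⟩ := hcpt.exists_isGreatest
    ⟨0, by simp, Metric.mem_closedBall_self hr.le⟩
  have hs1 : s < 1 := lt_of_le_of_ne hs.2 fun e ↦ hy (e ▸ hsD)
  have hout : ∀ t ∈ Set.Ioo s 1, γ t ∉ Metric.closedBall (γ 0) r := fun t ht htD ↦
    absurd (hmax ⟨⟨hs.1.trans ht.1.le, ht.2.le⟩, htD⟩) (not_le.2 ht.1)
  have hsph : dist (γ s) (γ 0) = r := by
    refine le_antisymm hsD (not_lt.1 fun hlt ↦ ?_)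
    have hev : ∀ᶠ t in nhdsWithin s (Set.Ioi s), dist (γ t) (γ 0) < r :=
      ((hγ.tendsto s).dist tendsto_const_nhds).eventually_lt_const hlt
        |>.filter_mono nhdsWithin_le_nhds
    obtain ⟨t, ht, ht'⟩ := (hev.and (Ioo_mem_nhdsGT hs1)).exists
    exact hout t ht' ht.le
  have hs0 : 0 < s := lt_of_le_of_ne hs.1 fun e ↦ hr.ne (by rw [← hsph, ← e, dist_self])
  have hsub : Set.Ioo s 1 ⊆ Set.Ioo 0 1 := Set.Ioo_subset_Ioo_left hs.1
  refine ⟨γ s, hsph, ⟨s, ⟨hs0, hs1⟩, rfl⟩, _, Set.image_mono hsub,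
    of_subinterval hγ hs1 (hinj.mono hsub), ?_⟩
  rw [Set.disjoint_left]
  rintro _ ⟨t, ht, rfl⟩
  exact hout t ht

end IsCurve

lemma isCurve_openSegment {E : Type*} [AddCommGroup E] [Module ℝ E] [TopologicalSpace E]
    [IsTopologicalAddGroup E] [ContinuousSMul ℝ E] {x y : E} (hxy : x ≠ y) :
    IsCurve x y (openSegment ℝ x y) :=
  ⟨AffineMap.lineMap x y, AffineMap.lineMap_continuous, by simp, by simp,
    (AffineMap.lineMap_injective ℝ hxy).injOn, (openSegment_eq_image_lineMap ℝ x y).symm⟩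

/-! ### Drawings as lists of arcs -/

/-- A drawn edge: a curve, recorded through its ends and its interior. The parametrisation is
forgotten, and the order of the ends is immaterial; a loop has `src = tgt`. -/
structure Arc (X : Type*) [TopologicalSpace X] where
  /-- One end. -/
  src : X
  /-- The other end. -/
  tgt : X
  /-- The set of interior points. -/
  inner : Set X
  /-- The interior is that of a curve between the ends. -/
  isCurve : IsCurve src tgt inner

section Topology

variable {X : Type*} [TopologicalSpace X]

/-- The same arc with its ends exchanged. -/
def Arc.symm (c : Arc X) : Arc X := ⟨c.tgt, c.src, c.inner, c.isCurve.symm⟩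

/-- The arc `c` has the ends `x` and `y`. -/
def Arc.Joins (c : Arc X) (x y : X) : Prop := (c.src = x ∧ c.tgt = y) ∨ (c.src = y ∧ c.tgt = x)

/-- A drawing without crossings of a multigraph whose vertices are the points of `V` and whose
edges are the members of the list `L`. -/
structure IsDrawing (V : Set X) (L : List (Arc X)) : Prop where
  /-- The first end of an edge is a vertex. -/
  src_mem : ∀ c ∈ L, c.src ∈ V
  /-- The second end of an edge is a vertex. -/
  tgt_mem : ∀ c ∈ L, c.tgt ∈ V
  /-- The interior of an edge contains no vertex. -/
  disjoint : ∀ c ∈ L, Disjoint c.inner V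
  /-- The interiors of different edges are disjoint. -/
  pairwise : L.Pairwise fun c d ↦ Disjoint c.inner d.inner

open Classical in
/-- The number of ends at `v` of the arcs in `L`; a loop counts twice. -/
noncomputable def degree (L : List (Arc X)) (v : X) : ℕ :=
  (L.map fun c ↦ (if c.src = v then 1 else 0) + (if c.tgt = v then 1 else 0)).sum

variable {V W : Set X} {K L : List (Arc X)}

@[simp] lemma degree_nil (v : X) : degree ([] : List (Arc X)) v = 0 := rfl

open Classical in
lemma degree_cons (c : Arc X) (L : List (Arc X)) (v : X) : degree (c :: L) v =
    (if c.src = v then 1 else 0) + (if c.tgt = v then 1 else 0) + degree L v := by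
  simp [degree]

@[simp] lemma degree_append (K L : List (Arc X)) (v : X) :
    degree (K ++ L) v = degree K v + degree L v := by
  simp [degree]

lemma degree_eq_of_perm (h : K.Perm L) (v : X) : degree K v = degree L v :=
  (h.map _).sum_eq

lemma degree_eq_zero {v : X} (h : ∀ c ∈ L, c.src ≠ v ∧ c.tgt ≠ v) : degree L v = 0 := by
  induction L with
  | nil => rfl
  | cons c L ih =>
    simp only [List.mem_cons, forall_eq_or_imp] at h
    rw [degree_cons, ih h.2, if_neg h.1.1, if_neg h.1.2]

namespace IsDrawing

lemma perm (h : IsDrawing V K) (hp : K.Perm L) : IsDrawing V L where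
  src_mem c hc := h.src_mem c (hp.mem_iff.2 hc)
  tgt_mem c hc := h.tgt_mem c (hp.mem_iff.2 hc)
  disjoint c hc := h.disjoint c (hp.mem_iff.2 hc)
  pairwise := h.pairwise.perm hp fun hcd ↦ hcd.symm

lemma append_iff : IsDrawing V (K ++ L) ↔
    IsDrawing V K ∧ IsDrawing V L ∧ ∀ c ∈ K, ∀ d ∈ L, Disjoint c.inner d.inner := by
  constructor
  · rintro ⟨h1, h2, h3, h4⟩
    simp only [List.mem_append] at h1 h2 h3
    rw [List.pairwise_append] at h4
    exact ⟨⟨fun c hc ↦ h1 c (.inl hc), fun c hc ↦ h2 c (.inl hc), fun c hc ↦ h3 c (.inl hc), h4.1⟩,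
      ⟨fun c hc ↦ h1 c (.inr hc), fun c hc ↦ h2 c (.inr hc), fun c hc ↦ h3 c (.inr hc), h4.2.1⟩,
      h4.2.2⟩
  · rintro ⟨h, h', hd⟩
    refine ⟨?_, ?_, ?_, List.pairwise_append.2 ⟨h.pairwise, h'.pairwise, hd⟩⟩ <;>
      simp only [List.mem_append] <;> rintro c (hc | hc)
    exacts [h.src_mem c hc, h'.src_mem c hc, h.tgt_mem c hc, h'.tgt_mem c hc, h.disjoint c hc,
      h'.disjoint c hc]

lemma cons_iff {c : Arc X} : IsDrawing V (c :: L) ↔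
    (c.src ∈ V ∧ c.tgt ∈ V ∧ Disjoint c.inner V) ∧ IsDrawing V L ∧
      ∀ d ∈ L, Disjoint c.inner d.inner := by
  have := append_iff (V := V) (K := [c]) (L := L)
  rw [List.singleton_append] at this
  rw [this]
  refine and_congr ⟨fun h ↦ ?_, fun h ↦ ?_⟩ (by simp)
  · exact ⟨h.src_mem c (by simp), h.tgt_mem c (by simp), h.disjoint c (by simp)⟩
  · exact ⟨by simpa using h.1, by simpa using h.2.1, by simpa using h.2.2, by simp⟩

/-- Vertices may be dropped from a drawing that are not ends of edges. -/
lemma subset (h : IsDrawing W L) (hV : V ⊆ W) (hL : ∀ c ∈ L, c.src ∈ V ∧ c.tgt ∈ V) :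
    IsDrawing V L :=
  ⟨fun c hc ↦ (hL c hc).1, fun c hc ↦ (hL c hc).2, fun c hc ↦ (h.disjoint c hc).mono_right hV,
    h.pairwise⟩

end IsDrawing

open Classical in
/-- The arc `c`, turned round if necessary so that it starts at `w` if it has an end there. -/
noncomputable def Arc.orient (w : X) (c : Arc X) : Arc X := if c.tgt = w then c.symm else c

lemma Arc.orient_inner (w : X) (c : Arc X) : (c.orient w).inner = c.inner := by
  unfold Arc.orient; split_ifs <;> rfl

lemma Arc.orient_of_ne {w : X} {c : Arc X} (h : c.tgt ≠ w) : c.orient w = c := if_neg h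

/-- After orientation, an arc that ends at `w` is a loop. -/
lemma Arc.orient_src {w : X} {c : Arc X} (h : (c.orient w).tgt = w) : (c.orient w).src = w := by
  by_cases hc : c.tgt = w
  · rw [Arc.orient, if_pos hc]; exact hc
  · rw [Arc.orient_of_ne hc] at h; exact (hc h).elim

lemma IsDrawing.orient (h : IsDrawing V L) (w : X) : IsDrawing V (L.map (Arc.orient w)) := by
  refine ⟨?_, ?_, ?_, ?_⟩
  · simp only [List.mem_map, forall_exists_index, and_imp, forall_apply_eq_imp_iff₂]
    intro c hc
    unfold Arc.orient; split_ifs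
    exacts [h.tgt_mem c hc, h.src_mem c hc]
  · simp only [List.mem_map, forall_exists_index, and_imp, forall_apply_eq_imp_iff₂]
    intro c hc
    unfold Arc.orient; split_ifs
    exacts [h.src_mem c hc, h.tgt_mem c hc]
  · simpa [Arc.orient_inner] using h.disjoint
  · simpa [List.pairwise_map, Arc.orient_inner] using h.pairwise

lemma degree_orient (L : List (Arc X)) (w v : X) :
    degree (L.map (Arc.orient w)) v = degree L v := by
  induction L with
  | nil => rfl
  | cons c L ih =>
    rw [List.map_cons, degree_cons, degree_cons, ih]
    by_cases hc : c.tgt = w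
    · rw [Arc.orient, if_pos hc]; exact congrArg (· + _) (add_comm _ _)
    · rw [Arc.orient_of_ne hc]

end Topology

/-- About a point off the drawing there is a disc which the drawing does not meet. -/
lemma IsDrawing.exists_closedBall {X : Type*} [MetricSpace X] {V : Set X} {L : List (Arc X)}
    (h : IsDrawing V L) (hV : V.Finite) {q : X} (hqV : q ∉ V) (hqL : ∀ c ∈ L, q ∉ c.inner) :
    ∃ r > 0, Disjoint V (Metric.closedBall q r) ∧
      ∀ c ∈ L, Disjoint c.inner (Metric.closedBall q r) := by
  have hcpt : IsCompact (V ∪ ⋃ c ∈ {c | c ∈ L}, insert c.src (insert c.tgt c.inner)) :=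
    hV.isCompact.union (L.finite_toSet.isCompact_biUnion fun c _ ↦ c.isCurve.isCompact)
  have hq : q ∉ V ∪ ⋃ c ∈ {c | c ∈ L}, insert c.src (insert c.tgt c.inner) := by
    simp only [Set.mem_union, Set.mem_iUnion, Set.mem_insert_iff, not_or, not_exists]
    exact ⟨hqV, fun c hc ↦ ⟨fun e ↦ hqV (e ▸ h.src_mem c hc), fun e ↦ hqV (e ▸ h.tgt_mem c hc),
      hqL c hc⟩⟩
  obtain ⟨r, hr, hsub⟩ := Metric.nhds_basis_closedBall.mem_iff.1
    (hcpt.isClosed.isOpen_compl.mem_nhds hq)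
  have hdisj := Set.disjoint_left.2 fun x hx hx' ↦ hsub hx hx'
  refine ⟨r, hr, hdisj.symm.mono_left Set.subset_union_left, fun c hc ↦ ?_⟩
  refine hdisj.symm.mono_left fun x hx ↦ Or.inr ?_
  exact Set.mem_biUnion (show c ∈ {c | c ∈ L} from hc) (Or.inr (Or.inr hx))

/-! ### Removing a vertex of degree four -/

section StrictConvex

variable {E : Type*} [NormedAddCommGroup E] [NormedSpace ℝ E] [StrictConvexSpace ℝ E]

/-- Four points on a circle can be paired so that the chords do not cross. If both pairings under
consideration had crossing chords, eliminating the fourth point between the two crossings would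
place one of the points `x`, `y`, `z` inside a chord between the other two. -/
lemma disjoint_chords {q : E} {r : ℝ} {x y z w : E} (hx : x ∈ Metric.sphere q r)
    (hy : y ∈ Metric.sphere q r) (hz : z ∈ Metric.sphere q r) (hxy : x ≠ y) (hxz : x ≠ z)
    (hyz : y ≠ z) :
    Disjoint (openSegment ℝ x y) (openSegment ℝ z w) ∨
      Disjoint (openSegment ℝ x z) (openSegment ℝ y w) := by
  by_contra! hcon
  obtain ⟨⟨p, ⟨a, b, ha, hb, hab, h1⟩, ⟨c, d, hc, hd, hcd, h2⟩⟩,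
    ⟨p', ⟨a', c', ha', hc', hac', h1'⟩, ⟨b', d', hb', hd', hbd', h2'⟩⟩⟩ :=
    And.imp Set.not_disjoint_iff.1 Set.not_disjoint_iff.1 hcon
  have hout : ∀ u ∈ Metric.sphere q r, u ∉ Metric.ball q r := fun u hu hu' ↦
    (Metric.mem_ball.1 hu').ne hu
  have hseg : ∀ u ∈ Metric.sphere q r, ∀ v ∈ Metric.sphere q r, u ≠ v →
      openSegment ℝ u v ⊆ Metric.ball q r := fun u hu v hv huv ↦
    openSegment_subset_ball_of_ne (Metric.sphere_subset_closedBall hu)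
      (Metric.sphere_subset_closedBall hv) huv
  have e1 : a • x + b • y = c • z + d • w := h1.trans h2.symm
  have e2 : a' • x + c' • z = b' • y + d' • w := h1'.trans h2'.symm
  have key : (a * d' - a' * d) • x + (b * d' + b' * d) • y = (c * d' + c' * d) • z := by
    linear_combination (norm := module) d' • e1 - d • e2
  have hβ : 0 < b * d' + b' * d := by positivity
  have hγ : 0 < c * d' + c' * d := by positivity
  have hsum : (a * d' - a' * d) + (b * d' + b' * d) = c * d' + c' * d := by
    linear_combination d' * hab - d' * hcd - d * hac' + d * hbd'
  generalize a * d' - a' * d = α at *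
  generalize b * d' + b' * d = β at *
  generalize c * d' + c' * d = γ at *
  rcases lt_trichotomy α 0 with hα | rfl | hα
  · refine hout y hy (hseg x hx z hz hxz ⟨-α / β, γ / β, by
      have := neg_pos.2 hα; positivity, by positivity, by field_simp; linarith, ?_⟩)
    have : β • y = (-α) • x + γ • z := by linear_combination (norm := module) key
    rw [div_eq_inv_mul, div_eq_inv_mul, mul_smul, mul_smul, ← smul_add, ← this, smul_smul,
      inv_mul_cancel₀ hβ.ne', one_smul]
  · rw [zero_add] at hsum
    rw [zero_smul, zero_add, hsum] at key
    exact hyz (smul_right_injective E hγ.ne' key)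
  · refine hout z hz (hseg x hx y hy hxy ⟨α / γ, β / γ, by positivity, by positivity, by
      field_simp; linarith, ?_⟩)
    rw [div_eq_inv_mul, div_eq_inv_mul, mul_smul, mul_smul, ← smul_add, key, smul_smul,
      inv_mul_cancel₀ hγ.ne', one_smul]

/-- Two curves outside a disc that start at different points of the bounding circle are joined by
a chord. -/
lemma IsCurve.join_chord {q : E} {r : ℝ} {a b a' b' : E} {J J' : Set E} (h : IsCurve a b J)
    (h' : IsCurve a' b' J') (ha : a ∈ Metric.sphere q r) (ha' : a' ∈ Metric.sphere q r)
    (hne : a ≠ a') (hJ : Disjoint J (Metric.closedBall q r))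
    (hJ' : Disjoint J' (Metric.closedBall q r)) (hJJ : Disjoint J J') :
    IsCurve b b' (insert a J ∪ insert a' J' ∪ openSegment ℝ a a') := by
  have hac := Metric.sphere_subset_closedBall ha
  have hac' := Metric.sphere_subset_closedBall ha'
  have hseg := openSegment_subset_ball_of_ne hac hac' hne
  have hsegc := hseg.trans Metric.ball_subset_closedBall
  have hout : ∀ u ∈ Metric.sphere q r, u ∉ openSegment ℝ a a' := fun u hu hu' ↦
    (Metric.mem_ball.1 (hseg hu')).ne hu
  have haJ : a ∉ J := Set.disjoint_right.1 hJ hac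
  have haJ' : a' ∉ J := Set.disjoint_right.1 hJ hac'
  have haJJ' : a' ∉ J' := Set.disjoint_right.1 hJ' hac'
  have h1 := (h.symm.trans (isCurve_openSegment hne) (hJ.mono_right hsegc) haJ (hout a ha)).trans
    h' (by
      rw [Set.disjoint_union_left, Set.disjoint_union_left, Set.disjoint_singleton_left]
      exact ⟨⟨hJJ, Set.disjoint_right.1 hJ' hac⟩, (hJ'.mono_right hsegc).symm⟩)
    (by
      rintro ((h | h) | h)
      exacts [haJ' h, hne h.symm, hout a' ha' h]) haJJ'
  convert h1 using 1
  ext x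
  simp only [Set.mem_union, Set.mem_insert_iff, Set.mem_singleton_iff]
  tauto

end StrictConvex

/-- Beyond a small circle about its start, an arc can be used as an arc from a point of the circle;
the new initial point and the new interior lie in the old interior. -/
lemma Arc.exists_exit {E : Type*} [PseudoMetricSpace E] (c : Arc E) {w : E} (hw : c.src = w)
    {r : ℝ} (hr : 0 < r)
    (ht : c.tgt ∉ Metric.closedBall w r) :
    ∃ a ∈ Metric.sphere w r, ∃ J, IsCurve a c.tgt J ∧ Disjoint J (Metric.closedBall w r) ∧
      insert a J ⊆ c.inner := by
  subst hw
  obtain ⟨a, ha, haI, J, hJ, hc, hd⟩ := c.isCurve.exists_exit hr ht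
  exact ⟨a, ha, J, hc, hd, Set.insert_subset haI hJ⟩

/-- Two arcs that leave a vertex are merged into one arc through that vertex. -/
lemma IsDrawing.merge_two {E : Type*} [TopologicalSpace E] {V : Set E} {L : List (Arc E)}
    {w : E} {c d : Arc E}
    (h : IsDrawing (insert w V) (c :: d :: L)) (hw : w ∉ V) (hc : c.src = w) (hd : d.src = w)
    (hcV : c.tgt ∈ V) (hdV : d.tgt ∈ V) (hL : IsDrawing V L) :
    ∃ e : Arc E, e.src = c.tgt ∧ e.tgt = d.tgt ∧ IsDrawing V (e :: L) := by
  have hLw := fun e he ↦ h.disjoint e (List.mem_cons_of_mem _ (List.mem_cons_of_mem _ he))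
  rw [cons_iff, cons_iff] at h
  simp only [List.mem_cons, forall_eq_or_imp] at h
  obtain ⟨⟨-, -, hcW⟩, ⟨⟨-, -, hdW⟩, -, hdL⟩, hcd, hcL⟩ := h
  rw [Set.disjoint_insert_right] at hcW hdW
  have hc' := c.isCurve
  have hd' := d.isCurve
  rw [hc] at hc'
  rw [hd] at hd'
  refine ⟨⟨_, _, _, hc'.symm.trans hd' hcd hcW.1 hdW.1⟩, rfl, rfl, ?_⟩
  rw [cons_iff]
  refine ⟨⟨hcV, hdV, ?_⟩, hL, fun e he ↦ ?_⟩
  · simp only [Set.disjoint_union_left, Set.disjoint_singleton_left]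
    exact ⟨⟨hcW.2, hw⟩, hdW.2⟩
  · simp only [Set.disjoint_union_left, Set.disjoint_singleton_left]
    exact ⟨⟨hcL e he, fun hwe ↦ Set.disjoint_left.1 (hLw e he) hwe (Set.mem_insert w V)⟩, hdL e he⟩

section StrictConvex

variable {E : Type*} [NormedAddCommGroup E] [NormedSpace ℝ E] [StrictConvexSpace ℝ E]

/-- Four arcs that leave a vertex `w` and get to a small circle about `w` at the points `a c` are
joined in pairs by chords of the circle that do not cross. -/
lemma IsDrawing.merge_chords {V : Set E} {L : List (Arc E)} {w : E} {r : ℝ} {a : Arc E → E}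
    {J : Arc E → Set E} {c₁ c₂ c₃ c₄ : Arc E}
    (h : IsDrawing (insert w V) (c₁ :: c₂ :: c₃ :: c₄ :: L))
    (hV : Disjoint V (Metric.closedBall w r))
    (hLr : ∀ c ∈ L, Disjoint c.inner (Metric.closedBall w r)) (hL : IsDrawing V L)
    (htgt : ∀ c ∈ [c₁, c₂, c₃, c₄], c.tgt ∈ V)
    (ha : ∀ c ∈ [c₁, c₂, c₃, c₄], a c ∈ Metric.sphere w r)
    (hJ : ∀ c ∈ [c₁, c₂, c₃, c₄], IsCurve (a c) c.tgt (J c))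
    (hJr : ∀ c ∈ [c₁, c₂, c₃, c₄], Disjoint (J c) (Metric.closedBall w r))
    (hsub : ∀ c ∈ [c₁, c₂, c₃, c₄], insert (a c) (J c) ⊆ c.inner)
    (hchord : Disjoint (openSegment ℝ (a c₁) (a c₂)) (openSegment ℝ (a c₃) (a c₄))) :
    ∃ e f : Arc E, e.src = c₁.tgt ∧ e.tgt = c₂.tgt ∧ f.src = c₃.tgt ∧ f.tgt = c₄.tgt ∧
      IsDrawing V (e :: f :: L) := by
  have hdisj : ∀ c ∈ [c₁, c₂, c₃, c₄], Disjoint c.inner V ∧ ∀ d ∈ L, Disjoint c.inner d.inner := by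
    intro c hc
    have h' : IsDrawing (insert w V) ([c₁, c₂, c₃, c₄] ++ L) := h
    rw [append_iff] at h'
    exact ⟨(h'.1.disjoint c hc).mono_right (Set.subset_insert _ _), h'.2.2 c hc⟩
  have hpair := h.pairwise
  simp only [List.pairwise_cons, List.mem_cons, forall_eq_or_imp] at hpair
  obtain ⟨⟨p12, p13, p14, -⟩, ⟨p23, p24, -⟩, ⟨p34, -⟩, -⟩ := hpair
  -- The new arcs consist of parts of old ones and of a chord inside the disc.
  have hball : ∀ c ∈ [c₁, c₂, c₃, c₄], Disjoint (insert (a c) (J c)) (Metric.ball w r) :=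
    fun c hc ↦ Set.disjoint_insert_left.2 ⟨fun hb ↦ (Metric.mem_ball.1 hb).ne (ha c hc),
      (hJr c hc).mono_right Metric.ball_subset_closedBall⟩
  have hjoin : ∀ c ∈ [c₁, c₂, c₃, c₄], ∀ d ∈ [c₁, c₂, c₃, c₄], Disjoint c.inner d.inner →
      IsCurve c.tgt d.tgt (insert (a c) (J c) ∪ insert (a d) (J d) ∪ openSegment ℝ (a c) (a d)) ∧
        openSegment ℝ (a c) (a d) ⊆ Metric.ball w r := by
    intro c hc d hd hcd
    have hne : a c ≠ a d := hcd.ne_of_mem (hsub c hc (Set.mem_insert _ _))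
      (hsub d hd (Set.mem_insert _ _))
    exact ⟨(hJ c hc).join_chord (hJ d hd) (ha c hc) (ha d hd) hne (hJr c hc) (hJr d hd)
      (hcd.mono ((Set.subset_insert _ _).trans (hsub c hc))
        ((Set.subset_insert _ _).trans (hsub d hd))),
      openSegment_subset_ball_of_ne (Metric.sphere_subset_closedBall (ha c hc))
        (Metric.sphere_subset_closedBall (ha d hd)) hne⟩
  have hnew : ∀ c ∈ [c₁, c₂, c₃, c₄], ∀ d ∈ [c₁, c₂, c₃, c₄], Disjoint c.inner d.inner →
      ∀ S : Set E, Disjoint c.inner S → Disjoint d.inner S → Disjoint S (Metric.closedBall w r) →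
      Disjoint (insert (a c) (J c) ∪ insert (a d) (J d) ∪ openSegment ℝ (a c) (a d)) S := by
    intro c hc d hd hcd S hcS hdS hS
    simp only [Set.disjoint_union_left]
    exact ⟨⟨hcS.mono_left (hsub c hc), hdS.mono_left (hsub d hd)⟩, hS.symm.mono_left
      ((hjoin c hc d hd hcd).2.trans Metric.ball_subset_closedBall)⟩
  have m1 : c₁ ∈ [c₁, c₂, c₃, c₄] := by simp
  have m2 : c₂ ∈ [c₁, c₂, c₃, c₄] := by simp
  have m3 : c₃ ∈ [c₁, c₂, c₃, c₄] := by simp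
  have m4 : c₄ ∈ [c₁, c₂, c₃, c₄] := by simp
  obtain ⟨hcu12, hs12⟩ := hjoin _ m1 _ m2 p12
  obtain ⟨hcu34, hs34⟩ := hjoin _ m3 _ m4 p34
  refine ⟨⟨_, _, _, hcu12⟩, ⟨_, _, _, hcu34⟩, rfl, rfl, rfl, rfl, ?_⟩
  simp only [cons_iff, List.mem_cons, forall_eq_or_imp]
  refine ⟨⟨htgt _ m1, htgt _ m2, hnew _ m1 _ m2 p12 _ (hdisj _ m1).1 (hdisj _ m2).1 hV⟩,
    ⟨⟨htgt _ m3, htgt _ m4, hnew _ m3 _ m4 p34 _ (hdisj _ m3).1 (hdisj _ m4).1 hV⟩, hL,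
      fun d hd ↦ hnew _ m3 _ m4 p34 _ ((hdisj _ m3).2 d hd) ((hdisj _ m4).2 d hd) (hLr d hd)⟩,
    ?_, fun d hd ↦ hnew _ m1 _ m2 p12 _ ((hdisj _ m1).2 d hd) ((hdisj _ m2).2 d hd) (hLr d hd)⟩
  simp only [Set.disjoint_union_left, Set.disjoint_union_right]
  exact ⟨⟨⟨⟨p13.mono (hsub _ m1) (hsub _ m3), p23.mono (hsub _ m2) (hsub _ m3)⟩,
      ((hball _ m3).mono_right hs12).symm⟩,
    ⟨p14.mono (hsub _ m1) (hsub _ m4), p24.mono (hsub _ m2) (hsub _ m4)⟩,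
      ((hball _ m4).mono_right hs12).symm⟩,
    ⟨(hball _ m1).mono_right hs34, (hball _ m2).mono_right hs34⟩, hchord⟩

/-- Four arcs that leave a vertex are replaced by two arcs that avoid it. -/
lemma IsDrawing.merge_four {V : Set E} {L : List (Arc E)} {w : E} {c₁ c₂ c₃ c₄ : Arc E}
    (h : IsDrawing (insert w V) (c₁ :: c₂ :: c₃ :: c₄ :: L)) (hfin : V.Finite) (hw : w ∉ V)
    (hsrc : ∀ c ∈ [c₁, c₂, c₃, c₄], c.src = w) (htgt : ∀ c ∈ [c₁, c₂, c₃, c₄], c.tgt ∈ V)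
    (hL : IsDrawing V L) :
    ∃ e f : Arc E, IsDrawing V (e :: f :: L) ∧
      ∀ v ∈ V, degree [e, f] v = degree [c₁, c₂, c₃, c₄] v := by
  have h' : IsDrawing (insert w V) ([c₁, c₂, c₃, c₄] ++ L) := h
  obtain ⟨h4, hLw, -⟩ := append_iff.1 h'
  obtain ⟨r, hr, hVr, hLr⟩ := hL.exists_closedBall hfin hw fun c hc hwc ↦
    Set.disjoint_left.1 (hLw.disjoint c hc) hwc (Set.mem_insert w V)
  choose! a ha J hJ hJr hsub using fun c (hc : c ∈ [c₁, c₂, c₃, c₄]) ↦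
    c.exists_exit (hsrc c hc) hr (Set.disjoint_left.1 hVr (htgt c hc))
  have hpair := h4.pairwise
  simp only [List.pairwise_cons, List.mem_cons, forall_eq_or_imp] at hpair
  obtain ⟨⟨p12, p13, p14, -⟩, ⟨p23, p24, -⟩, ⟨p34, -⟩, -⟩ := hpair
  have hmem : ∀ c ∈ [c₁, c₂, c₃, c₄], a c ∈ c.inner := fun c hc ↦ hsub c hc (Set.mem_insert _ _)
  have hdeg : ∀ v ∈ V, ∀ c ∈ [c₁, c₂, c₃, c₄], c.src ≠ v := fun v hv c hc e ↦
    hw (hsrc c hc ▸ e ▸ hv)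
  rcases disjoint_chords (w := a c₄) (ha c₁ (by simp)) (ha c₂ (by simp)) (ha c₃ (by simp))
    (p12.ne_of_mem (hmem c₁ (by simp)) (hmem c₂ (by simp)))
    (p13.ne_of_mem (hmem c₁ (by simp)) (hmem c₃ (by simp)))
    (p23.ne_of_mem (hmem c₂ (by simp)) (hmem c₃ (by simp))) with hch | hch
  · obtain ⟨e, f, e1, e2, f1, f2, hd⟩ := h.merge_chords hVr hLr hL htgt ha hJ hJr hsub hch
    refine ⟨e, f, hd, fun v hv ↦ ?_⟩
    have := hdeg v hv
    simp only [List.mem_cons, forall_eq_or_imp] at this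
    simp only [degree_cons, degree_nil, this, if_false]
    rw [e1, e2, f1, f2]
    omega
  · have hp : [c₁, c₂, c₃, c₄].Perm [c₁, c₃, c₂, c₄] := (List.Perm.swap _ _ _).cons _
    simp only [hp.mem_iff] at htgt ha hJ hJr hsub
    obtain ⟨e, f, e1, e2, f1, f2, hd⟩ :=
      (h.perm ((List.Perm.swap _ _ _).cons _)).merge_chords hVr hLr hL htgt ha hJ hJr hsub hch
    refine ⟨e, f, hd, fun v hv ↦ ?_⟩
    have := hdeg v hv
    simp only [List.mem_cons, forall_eq_or_imp] at this
    simp only [degree_cons, degree_nil, this, if_false]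
    rw [e1, e2, f1, f2]
    omega

open Classical in
/-- A vertex of degree four can be removed from a drawing so that the degrees of the other vertices
and the edges between them are preserved: loops at the vertex are deleted, and the other arcs at
it are merged in pairs. -/
lemma IsDrawing.remove_vertex {V : Set E} {L : List (Arc E)} {w : E}
    (h : IsDrawing (insert w V) L) (hfin : V.Finite) (hw : w ∉ V) (hdeg : degree L w = 4) :
    ∃ L', IsDrawing V L' ∧ (∀ v ∈ V, degree L' v = degree L v) ∧
      ∀ c ∈ L, c.src ∈ V → c.tgt ∈ V → c ∈ L' := by
  set M := L.map (Arc.orient w) with hM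
  have hMd : IsDrawing (insert w V) M := h.orient w
  have hMtgt : ∀ c ∈ M, c.tgt = w → c.src = w := by
    simp only [hM, List.mem_map, forall_exists_index, and_imp, forall_apply_eq_imp_iff₂]
    exact fun c _ ↦ Arc.orient_src
  -- `B` holds the loops at `w`, `N` the other arcs at `w`, `L₀` the arcs that do not end at `w`.
  set A := M.filter (fun c ↦ c.src = w) with hA
  set L₀ := M.filter (fun c ↦ ¬ c.src = w) with hL₀
  set B := A.filter (fun c ↦ c.tgt = w) with hB
  set N := A.filter (fun c ↦ ¬ c.tgt = w) with hN
  have hperm : (B ++ (N ++ L₀)).Perm M := by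
    have h1 : (A ++ L₀).Perm M := by
      simpa [hA, hL₀] using List.filter_append_perm (fun c : Arc E ↦ decide (c.src = w)) M
    have h2 : (B ++ N).Perm A := by
      simpa [hB, hN] using List.filter_append_perm (fun c : Arc E ↦ decide (c.tgt = w)) A
    rw [← List.append_assoc]
    exact (h2.append_right _).trans h1
  have hBmem : ∀ c ∈ B, c.src = w ∧ c.tgt = w := fun c hc ↦ by
    simp only [hB, hA, List.mem_filter, decide_eq_true_eq] at hc
    exact ⟨hc.1.2, hc.2⟩
  have hNmem : ∀ c ∈ N, c.src = w ∧ c.tgt ∈ V := fun c hc ↦ by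
    simp only [hN, hA, List.mem_filter, decide_eq_true_eq] at hc
    exact ⟨hc.1.2, (hMd.tgt_mem c hc.1.1).resolve_left hc.2⟩
  have hLmem : ∀ c ∈ L₀, c.src ∈ V ∧ c.tgt ∈ V := fun c hc ↦ by
    simp only [hL₀, List.mem_filter, decide_eq_true_eq] at hc
    exact ⟨(hMd.src_mem c hc.1).resolve_left hc.2,
      (hMd.tgt_mem c hc.1).resolve_left fun e ↦ hc.2 (hMtgt c hc.1 e)⟩
  have hNL : IsDrawing (insert w V) (N ++ L₀) := (append_iff.1 (hMd.perm hperm.symm)).2.1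
  have hL₀d : IsDrawing V L₀ := (append_iff.1 hNL).2.1.subset (Set.subset_insert _ _) hLmem
  have hne : ∀ v ∈ V, w ≠ v := fun v hv e ↦ hw (e ▸ hv)
  have hdegV : ∀ v ∈ V, degree L v = degree N v + degree L₀ v := fun v hv ↦ by
    rw [← degree_orient L w, ← degree_eq_of_perm hperm, degree_append, degree_append,
      degree_eq_zero (L := B), zero_add]
    exact fun c hc ↦ by rw [(hBmem c hc).1, (hBmem c hc).2]; exact ⟨hne v hv, hne v hv⟩
  have hBdeg : degree B w = 2 * B.length := by
    generalize B = B' at hBmem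
    induction B' with
    | nil => rfl
    | cons c B' ih =>
      simp only [List.mem_cons, forall_eq_or_imp] at hBmem
      rw [degree_cons, ih hBmem.2, if_pos hBmem.1.1, if_pos hBmem.1.2, List.length_cons]
      ring
  have hNdeg : degree N w = N.length := by
    clear_value N
    clear hN hperm hNL hdegV
    induction N with
    | nil => rfl
    | cons c N' ih =>
      simp only [List.mem_cons, forall_eq_or_imp] at hNmem
      rw [degree_cons, ih hNmem.2, if_pos hNmem.1.1, if_neg (hne _ hNmem.1.2).symm,
        List.length_cons]
      ring
  -- Hence zero, two or four arcs besides the loops leave `w`.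
  have hdeg4 : 2 * B.length + N.length = 4 := by
    rw [← hdeg, ← degree_orient L w, ← degree_eq_of_perm hperm, degree_append, degree_append, hBdeg,
      hNdeg, degree_eq_zero (L := L₀), add_zero]
    exact fun c hc ↦ ⟨(hne _ (hLmem c hc).1).symm, (hne _ (hLmem c hc).2).symm⟩
  have hkeep : ∀ c ∈ L, c.src ∈ V → c.tgt ∈ V → c ∈ L₀ := fun c hc hs ht ↦ by
    simp only [hL₀, hM, List.mem_filter, decide_eq_true_eq]
    exact ⟨List.mem_map.2 ⟨c, hc, Arc.orient_of_ne (hne _ ht).symm⟩, (hne _ hs).symm⟩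
  clear_value N
  match N, hdeg4 with
  | [], _ => exact ⟨L₀, hL₀d, fun v hv ↦ by simp [hdegV v hv], hkeep⟩
  | [c, d], _ =>
    simp only [List.mem_cons, forall_eq_or_imp] at hNmem
    obtain ⟨⟨hcs, hct⟩, ⟨hds, hdt⟩, -⟩ := hNmem
    obtain ⟨e, es, et, he⟩ := IsDrawing.merge_two hNL hw hcs hds hct hdt hL₀d
    refine ⟨e :: L₀, he, fun v hv ↦ ?_, fun c hc hs ht ↦ List.mem_cons_of_mem _ (hkeep c hc hs ht)⟩
    rw [hdegV v hv]
    simp only [degree_cons, es, et, hcs, hds, degree_nil, hne v hv, if_false]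
    omega
  | [c₁, c₂, c₃, c₄], _ =>
    obtain ⟨e, f, he, hef⟩ := IsDrawing.merge_four hNL hfin hw (fun c hc ↦ (hNmem c hc).1)
      (fun c hc ↦ (hNmem c hc).2) hL₀d
    refine ⟨e :: f :: L₀, he, fun v hv ↦ ?_,
      fun c hc hs ht ↦ List.mem_cons_of_mem _ (List.mem_cons_of_mem _ (hkeep c hc hs ht))⟩
    rw [hdegV v hv, ← hef v hv, ← degree_append]
    rfl
  | [_], h' => simp only [List.length_cons, List.length_nil] at h'; omega
  | [_, _, _], h' => simp only [List.length_cons, List.length_nil] at h'; omega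
  | _ :: _ :: _ :: _ :: _ :: _, h' => simp only [List.length_cons] at h'; omega

/-- In a drawing in which all vertices have degree four, all vertices outside a given set can be
removed. -/
lemma IsDrawing.remove_vertices {S T : Set E} {L : List (Arc E)} (hS : S.Finite) (hT : T.Finite)
    (hST : Disjoint T S) (h : IsDrawing (T ∪ S) L) (hdeg : ∀ v ∈ T ∪ S, degree L v = 4) :
    ∃ L', IsDrawing S L' ∧ (∀ v ∈ S, degree L' v = 4) ∧
      ∀ c ∈ L, c.src ∈ S → c.tgt ∈ S → c ∈ L' := by
  induction T, hT using Set.Finite.induction_on generalizing L with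
  | empty =>
    simp only [Set.empty_union] at h hdeg
    exact ⟨L, h, hdeg, fun c hc _ _ ↦ hc⟩
  | @insert w T hwT hT ih =>
    rw [Set.insert_union] at h hdeg
    rw [Set.disjoint_insert_left] at hST
    have hw : w ∉ T ∪ S := fun hw ↦ hw.elim hwT hST.1
    obtain ⟨L₁, h₁, hd₁, hk₁⟩ := h.remove_vertex (hT.union hS) hw (hdeg w (Set.mem_insert _ _))
    obtain ⟨L₂, h₂, hd₂, hk₂⟩ := ih hST.2 h₁ fun v hv ↦
      (hd₁ v hv).trans (hdeg v (Set.mem_insert_of_mem _ hv))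
    exact ⟨L₂, h₂, hd₂, fun c hc hs ht ↦ hk₂ c (hk₁ c hc (Or.inr hs) (Or.inr ht)) hs ht⟩

end StrictConvex

/-! ### Replacing an edge by a gadget -/

/-- Positions for the vertices of an octahedron. The opposite pairs are `0` and `2`, `1` and `3`,
`4` and `5`; the first four vertices lie on a line, the other two on either side of it. -/
def gadgetPoint : Fin 6 → ℝ × ℝ := ![(0, 0), (2, 0), (4, 0), (6, 0), (3, 1), (3, -1)]

/-- The edges of the octahedron without the edge between `0` and `3`. -/
def gadgetEdges : List {e : Fin 6 × Fin 6 // e.1 ≠ e.2} :=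
  [⟨(0, 1), by decide⟩, ⟨(1, 2), by decide⟩, ⟨(2, 3), by decide⟩,
    ⟨(0, 4), by decide⟩, ⟨(1, 4), by decide⟩, ⟨(2, 4), by decide⟩, ⟨(3, 4), by decide⟩,
    ⟨(0, 5), by decide⟩, ⟨(1, 5), by decide⟩, ⟨(2, 5), by decide⟩, ⟨(3, 5), by decide⟩]

lemma gadgetPoint_injective : Function.Injective gadgetPoint := by
  intro i j h
  fin_cases i <;> fin_cases j <;> first | rfl | (norm_num [gadgetPoint] at h)

lemma gadget_pairwise_disjoint : gadgetEdges.Pairwise fun e f ↦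
    Disjoint (openSegment ℝ (gadgetPoint e.1.1) (gadgetPoint e.1.2))
      (openSegment ℝ (gadgetPoint f.1.1) (gadgetPoint f.1.2)) := by
  simp only [gadgetEdges, List.pairwise_cons, List.mem_cons, forall_eq_or_imp, List.not_mem_nil,
    false_imp_iff, forall_true_iff, and_true, List.Pairwise.nil]
  and_intros
  all_goals
    rw [Set.disjoint_left]
    rintro _ ⟨a, b, ha, hb, hab, rfl⟩ ⟨c, d, hc, hd, hcd, h⟩
    simp only [gadgetPoint, Matrix.cons_val, Prod.smul_mk, Prod.mk_add_mk, Prod.mk.injEq,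
      smul_eq_mul] at h
    linarith [h.1, h.2]

lemma gadget_notMem_openSegment : ∀ e ∈ gadgetEdges, ∀ i,
    gadgetPoint i ∉ openSegment ℝ (gadgetPoint e.1.1) (gadgetPoint e.1.2) := by
  simp only [gadgetEdges, List.mem_cons, forall_eq_or_imp, List.not_mem_nil,
    false_imp_iff, forall_true_iff, and_true]
  and_intros
  all_goals
    intro i
    fin_cases i
  all_goals
    rintro ⟨a, b, ha, hb, hab, h⟩
    simp only [gadgetPoint, Fin.reduceFinMk, Fin.mk_one, Fin.zero_eta,
      Matrix.cons_val, Prod.smul_mk, Prod.mk_add_mk, Prod.mk.injEq, smul_eq_mul] at h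
    linarith [h.1, h.2]

variable {E : Type*} [NormedAddCommGroup E] [NormedSpace ℝ E]

/-- An affine injective map takes the gadget into a given disc so that its vertices `0` and `3`
become two given points of the disc: along the chord it is determined by these, across the chord
it may be flattened as much as needed. -/
lemma exists_gadget_in_closedBall [StrictConvexSpace ℝ E] (hE : 1 < Module.finrank ℝ E)
    {q a b : E} {r : ℝ} (ha : a ∈ Metric.closedBall q r) (hb : b ∈ Metric.closedBall q r)
    (hab : a ≠ b) :
    ∃ φ : ℝ × ℝ →ᵃ[ℝ] E, Function.Injective φ ∧ φ (gadgetPoint 0) = a ∧ φ (gadgetPoint 3) = b ∧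
      ∀ i, φ (gadgetPoint i) ∈ Metric.closedBall q r := by
  obtain ⟨u, hu⟩ := exists_linearIndependent_pair_of_one_lt_finrank hE (sub_ne_zero.2 hab.symm)
  rw [LinearIndependent.pair_iff] at hu
  -- The vertices `4` and `5` go to `m s` and `m (-s)`, close to the midpoint of the chord.
  set m : ℝ → E := fun s ↦ a + (2⁻¹ : ℝ) • (b - a) + s • u with hm
  have hm0 : m 0 ∈ Metric.ball q r :=
    openSegment_subset_ball_of_ne ha hb hab
      ⟨2⁻¹, 2⁻¹, by norm_num, by norm_num, by norm_num, by simp only [hm]; module⟩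
  have hev : ∀ᶠ s in nhds (0 : ℝ), m s ∈ Metric.ball q r := by
    have hc : Continuous m := by fun_prop
    exact hc.continuousAt.eventually (Metric.isOpen_ball.mem_nhds hm0)
  have hev' : ∀ᶠ s in nhds (0 : ℝ), m (-s) ∈ Metric.ball q r := by
    have hc : Continuous fun s ↦ m (-s) := by fun_prop
    exact hc.continuousAt.eventually (Metric.isOpen_ball.mem_nhds (by simpa using hm0))
  obtain ⟨s, ⟨hs, hs'⟩, hs0⟩ :=
    (((hev.and hev').filter_mono nhdsWithin_le_nhds).and
      (self_mem_nhdsWithin (a := (0 : ℝ)) (s := {0}ᶜ))).exists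
  -- The factor `6⁻¹` takes the abscissa of vertex `3` to the point `b`.
  let φ : ℝ × ℝ →ᵃ[ℝ] E :=
    ((LinearMap.toSpanSingleton ℝ E ((6⁻¹ : ℝ) • (b - a))).coprod
      (LinearMap.toSpanSingleton ℝ E (s • u))).toAffineMap + AffineMap.const ℝ _ a
  have hφ : ∀ x y, φ (x, y) = x • (6⁻¹ : ℝ) • (b - a) + y • s • u + a := fun x y ↦ by simp [φ]
  have hseg : ∀ t ∈ Set.Icc (0 : ℝ) 1, a + t • (b - a) ∈ Metric.closedBall q r := fun t ht ↦
    (convex_closedBall q r).add_smul_sub_mem ha hb ht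
  refine ⟨φ, ?_, ?_, ?_, ?_⟩
  · rintro ⟨x, y⟩ ⟨x', y'⟩ h
    rw [hφ, hφ] at h
    obtain ⟨h1, h2⟩ := hu ((x - x') * 6⁻¹) ((y - y') * s)
      (by linear_combination (norm := module) h)
    rw [mul_eq_zero, sub_eq_zero] at h1 h2
    rw [h1.resolve_right (by norm_num), h2.resolve_right hs0]
  · simp [gadgetPoint, hφ]
  · rw [show gadgetPoint 3 = (6, 0) from rfl, hφ]
    module
  · have h0 : ∀ x, φ (x, 0) = a + (x * 6⁻¹) • (b - a) := fun x ↦ by rw [hφ]; module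
    intro i
    fin_cases i
    · exact (h0 0) ▸ hseg _ (by norm_num)
    · exact (h0 2) ▸ hseg _ (by norm_num)
    · exact (h0 4) ▸ hseg _ (by norm_num)
    · exact (h0 6) ▸ hseg _ (by norm_num)
    · have : φ (3, 1) = m s := by rw [hφ]; module
      exact this ▸ Metric.ball_subset_closedBall hs
    · have : φ (3, -1) = m (-s) := by rw [hφ]; module
      exact this ▸ Metric.ball_subset_closedBall hs'

/-- The list `L` is the edge list of a simple graph: there are no loops and no parallel arcs. -/
def IsSimple {X : Type*} [TopologicalSpace X] (L : List (Arc X)) : Prop :=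
  (∀ c ∈ L, c.src ≠ c.tgt) ∧ L.Pairwise fun c d ↦ ¬ d.Joins c.src c.tgt

/-- The gadget as a list of segments, for given positions of its vertices. -/
def gadget {ψ : Fin 6 → E} (hψ : Function.Injective ψ) : List (Arc E) :=
  gadgetEdges.map fun e ↦
    ⟨ψ e.1.1, ψ e.1.2, openSegment ℝ (ψ e.1.1) (ψ e.1.2), isCurve_openSegment (hψ.ne e.2)⟩

lemma degree_gadget {ψ : Fin 6 → E} (hψ : Function.Injective ψ) (i : Fin 6) :
    degree (gadget hψ) (ψ i) = if i = 0 ∨ i = 3 then 3 else 4 := by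
  simp only [gadget, gadgetEdges, List.map_cons, List.map_nil, degree_cons, hψ.eq_iff, degree_nil]
  fin_cases i <;> simp

lemma isSimple_gadget {ψ : Fin 6 → E} (hψ : Function.Injective ψ) : IsSimple (gadget hψ) := by
  constructor
  · simp only [gadget, List.mem_map, forall_exists_index, and_imp, forall_apply_eq_imp_iff₂]
    exact fun e _ ↦ hψ.ne e.2
  · simp only [gadget, List.pairwise_map, Arc.Joins, hψ.eq_iff]
    decide

open Classical in
/-- An edge of a drawing can be replaced by an octahedron without an edge `0`–`3`, together with
arcs that join the ends of the edge to the vertices `0` and `3`. -/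
lemma IsDrawing.replace_by_gadget [StrictConvexSpace ℝ E] (hE : 1 < Module.finrank ℝ E)
    {V : Set E} {L : List (Arc E)} {c : Arc E} (hfin : V.Finite) (h : IsDrawing V (c :: L)) :
    ∃ (W : Set E) (K : List (Arc E)), W.Finite ∧ Disjoint W V ∧ IsDrawing (W ∪ V) (K ++ L) ∧
      (∀ v ∈ V, degree (K ++ L) v = degree (c :: L) v) ∧ (∀ v ∈ W, degree (K ++ L) v = 4) ∧
      IsSimple K ∧ ∀ k ∈ K, k.src ∈ W ∨ k.tgt ∈ W := by
  obtain ⟨⟨hsV, htV, hcV⟩, hL, hcL⟩ := cons_iff.1 h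
  -- The two parts of the edge on either side of `q` are cut where they leave a disc about `q`.
  obtain ⟨q, hq⟩ := c.isCurve.nonempty
  obtain ⟨r, hr, hVr, hLr⟩ := hL.exists_closedBall hfin (Set.disjoint_left.1 hcV hq)
    fun d hd ↦ Set.disjoint_left.1 (hcL d hd) hq
  obtain ⟨I₁, I₂, hI₁, hI₂, hs₁, hs₂, hI⟩ := c.isCurve.exists_split hq
  obtain ⟨a, ha, haI, J₁, hJI₁, hJ₁, hJr₁⟩ :=
    hI₁.symm.exists_exit hr (Set.disjoint_left.1 hVr hsV)
  obtain ⟨b, hb, hbI, J₂, hJI₂, hJ₂, hJr₂⟩ := hI₂.exists_exit hr (Set.disjoint_left.1 hVr htV)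
  have hab : a ≠ b := hI.ne_of_mem haI hbI
  obtain ⟨φ, hφ, rfl, rfl, hφr⟩ := exists_gadget_in_closedBall hE
    (Metric.sphere_subset_closedBall ha) (Metric.sphere_subset_closedBall hb) hab
  set ψ : Fin 6 → E := fun i ↦ φ (gadgetPoint i) with hψdef
  have hψ : Function.Injective ψ := hφ.comp gadgetPoint_injective
  have hψV : ∀ i, ψ i ∉ V := fun i hi ↦ Set.disjoint_left.1 hVr hi (hφr i)
  have hVψ : ∀ v ∈ V, ∀ i, ψ i ≠ v := fun v hv i e ↦ hψV i (e ▸ hv)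
  have hWr : Set.range ψ ⊆ Metric.closedBall q r := Set.range_subset_iff.2 hφr
  have hGmem : ∀ k ∈ gadget hψ, (∃ i, k.src = ψ i) ∧ (∃ i, k.tgt = ψ i) ∧
      k.inner ⊆ Metric.closedBall q r ∧ Disjoint k.inner (Set.range ψ) := by
    simp only [gadget, List.mem_map, forall_exists_index, and_imp, forall_apply_eq_imp_iff₂]
    refine fun e he ↦ ⟨⟨_, rfl⟩, ⟨_, rfl⟩,
      (convex_closedBall q r).openSegment_subset (hφr _) (hφr _), ?_⟩
    rw [Set.disjoint_right]
    rintro _ ⟨i, rfl⟩ hi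
    rw [hψdef] at hi
    simp only at hi
    rw [← image_openSegment, hφ.mem_set_image] at hi
    exact gadget_notMem_openSegment e he i hi
  have hG : IsDrawing (Set.range ψ ∪ V) (gadget hψ) := by
    refine ⟨fun k hk ↦ ?_, fun k hk ↦ ?_, fun k hk ↦ ?_, ?_⟩
    · obtain ⟨i, hi⟩ := (hGmem k hk).1
      exact Or.inl ⟨i, hi.symm⟩
    · obtain ⟨i, hi⟩ := (hGmem k hk).2.1
      exact Or.inl ⟨i, hi.symm⟩
    · exact Set.disjoint_union_right.2 ⟨(hGmem k hk).2.2.2,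
        (hVr.mono_right (hGmem k hk).2.2.1).symm⟩
    · rw [gadget, List.pairwise_map]
      refine gadget_pairwise_disjoint.imp fun {e f} hef ↦ ?_
      simp only [hψdef, ← image_openSegment]
      exact (Set.disjoint_image_iff hφ).2 hef
  set t₁ : Arc E := ⟨_, _, _, hJ₁⟩ with ht₁
  set t₂ : Arc E := ⟨_, _, _, hJ₂⟩ with ht₂
  have hc₁ : J₁ ⊆ c.inner := hJI₁.trans hs₁
  have hc₂ : J₂ ⊆ c.inner := hJI₂.trans hs₂
  refine ⟨Set.range ψ, t₁ :: t₂ :: gadget hψ, Set.finite_range ψ,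
    (hVr.mono_right hWr).symm, ?_, ?_, ?_, ?_, ?_⟩
  · have hL' : IsDrawing (Set.range ψ ∪ V) L :=
      ⟨fun d hd ↦ Or.inr (hL.src_mem d hd), fun d hd ↦ Or.inr (hL.tgt_mem d hd),
        fun d hd ↦ Set.disjoint_union_right.2 ⟨(hLr d hd).mono_right hWr, hL.disjoint d hd⟩,
        hL.pairwise⟩
    simp only [List.cons_append, cons_iff, append_iff, List.mem_cons, List.mem_append,
      or_imp, forall_and, forall_eq]
    refine ⟨⟨Or.inl ⟨0, rfl⟩, Or.inr hsV, Set.disjoint_union_right.2 ⟨hJr₁.mono_right hWr,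
      hcV.mono_left hc₁⟩⟩, ⟨⟨Or.inl ⟨3, rfl⟩, Or.inr htV,
      Set.disjoint_union_right.2 ⟨hJr₂.mono_right hWr, hcV.mono_left hc₂⟩⟩,
      ⟨hG, hL', fun k hk d hd ↦ ((hLr d hd).mono_right (hGmem k hk).2.2.1).symm⟩, ?_, ?_⟩,
      ?_, ?_, ?_⟩
    · exact fun k hk ↦ hJr₂.mono_right (hGmem k hk).2.2.1
    · exact fun d hd ↦ (hcL d hd).mono_left hc₂
    · exact hI.mono hJI₁ hJI₂
    · exact fun k hk ↦ hJr₁.mono_right (hGmem k hk).2.2.1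
    · exact fun d hd ↦ (hcL d hd).mono_left hc₁
  · intro v hv
    have hGv : degree (gadget hψ) v = 0 := degree_eq_zero fun k hk ↦ by
      obtain ⟨⟨i, hi⟩, ⟨j, hj⟩, -⟩ := hGmem k hk
      rw [hi, hj]
      exact ⟨hVψ v hv i, hVψ v hv j⟩
    simp only [degree_append, degree_cons, hGv, ht₁, ht₂]
    rw [if_neg (hVψ v hv 0), if_neg (hVψ v hv 3)]
    omega
  · rintro _ ⟨i, rfl⟩
    have hLi : degree L (ψ i) = 0 := degree_eq_zero fun d hd ↦
      ⟨(hVψ _ (hL.src_mem d hd) i).symm, (hVψ _ (hL.tgt_mem d hd) i).symm⟩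
    simp only [degree_append, degree_cons, hLi, degree_gadget, ht₁, ht₂]
    rw [if_neg (hVψ _ hsV i).symm, if_neg (hVψ _ htV i).symm]
    change (if ψ 0 = ψ i then 1 else 0) + 0 + ((if ψ 3 = ψ i then 1 else 0) + 0 + _) + 0 = 4
    simp only [hψ.eq_iff]
    fin_cases i <;> simp
  · have hGt : ∀ k ∈ gadget hψ, ∀ v ∈ V, ∀ x, ¬ k.Joins x v := by
      rintro k hk v hv x (⟨-, e⟩ | ⟨e, -⟩)
      · obtain ⟨i, hi⟩ := (hGmem k hk).2.1
        exact hVψ v hv i (hi ▸ e)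
      · obtain ⟨i, hi⟩ := (hGmem k hk).1
        exact hVψ v hv i (hi ▸ e)
    obtain ⟨hG₁, hG₂⟩ := isSimple_gadget hψ
    refine ⟨?_, List.pairwise_cons.2 ⟨?_, List.pairwise_cons.2 ⟨fun k hk ↦ hGt k hk _ htV _, hG₂⟩⟩⟩
    · simp only [List.mem_cons, forall_eq_or_imp]
      exact ⟨hVψ _ hsV 0, hVψ _ htV 3, hG₁⟩
    · simp only [List.mem_cons, forall_eq_or_imp]
      refine ⟨?_, fun k hk ↦ hGt k hk _ hsV _⟩
      rintro (⟨e, -⟩ | ⟨e, -⟩)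
      · exact hab e.symm
      · exact hVψ _ hsV 3 e
  · simp only [List.mem_cons, forall_eq_or_imp]
    exact ⟨Or.inl ⟨0, rfl⟩, Or.inl ⟨3, rfl⟩, fun k hk ↦ Or.inl <| by
      obtain ⟨i, hi⟩ := (hGmem k hk).1
      exact ⟨i, hi.symm⟩⟩

/-- If a regular drawing of degree four contains a simple part, all the other edges can be replaced
by gadgets to give a simple drawing. -/
lemma IsDrawing.exists_isSimple [StrictConvexSpace ℝ E] (hE : 1 < Module.finrank ℝ E)
    {V : Set E} {A B : List (Arc E)} (hfin : V.Finite) (h : IsDrawing V (A ++ B))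
    (hA : IsSimple A) (hdeg : ∀ v ∈ V, degree (A ++ B) v = 4) :
    ∃ W L, V ⊆ W ∧ W.Finite ∧ IsDrawing W L ∧ IsSimple L ∧ (∀ v ∈ W, degree L v = 4) ∧
      ∀ c ∈ A, c ∈ L := by
  induction B generalizing V A with
  | nil =>
    rw [List.append_nil] at h hdeg
    exact ⟨V, A, subset_rfl, hfin, h, hA, hdeg, fun c hc ↦ hc⟩
  | cons c B ih =>
    have hp : (A ++ c :: B).Perm (c :: (A ++ B)) := List.perm_middle
    have h' := h.perm hp
    obtain ⟨W, K, hW, hWV, hK, hKV, hKW, hKs, hKm⟩ := h'.replace_by_gadget hE hfin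
    have hAd := (append_iff.1 h).1
    rw [← List.append_assoc] at hK hKV hKW
    have hKA : IsSimple (K ++ A) := by
      refine ⟨fun k hk ↦ (List.mem_append.1 hk).elim (hKs.1 k) (hA.1 k),
        List.pairwise_append.2 ⟨hKs.2, hA.2, fun k hk a ha hj ↦ ?_⟩⟩
      have hs := hAd.src_mem a ha
      have ht := hAd.tgt_mem a ha
      rw [Set.disjoint_left] at hWV
      rcases hj with ⟨e, e'⟩ | ⟨e, e'⟩ <;> rw [e] at hs <;> rw [e'] at ht <;>
        exact (hKm k hk).elim (fun hm ↦ hWV hm ‹_›) (fun hm ↦ hWV hm ‹_›)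
    obtain ⟨W', L, hsub, hW', hL, hLs, hL4, hLA⟩ := ih (hW.union hfin) hK hKA
      (by
        rintro v (hv | hv)
        · exact hKW v hv
        · rw [hKV v hv, ← degree_eq_of_perm hp, hdeg v hv])
    exact ⟨W', L, Set.subset_union_right.trans hsub, hW', hL, hLs, hL4,
      fun a ha ↦ hLA a (List.mem_append_right _ ha)⟩

/-- Every list of arcs has a simple part that joins the same pairs of different points. -/
lemma exists_perm_isSimple {X : Type*} [TopologicalSpace X] (L : List (Arc X)) :
    ∃ A B, (A ++ B).Perm L ∧ IsSimple A ∧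
      ∀ c ∈ L, c.src ≠ c.tgt → ∃ a ∈ A, a.Joins c.src c.tgt := by
  induction L with
  | nil => exact ⟨[], [], .nil, ⟨by simp, .nil⟩, by simp⟩
  | cons c L ih =>
    obtain ⟨A, B, hp, hA, hL⟩ := ih
    by_cases hc : c.src ≠ c.tgt → ∃ a ∈ A, a.Joins c.src c.tgt
    · refine ⟨A, c :: B, List.perm_middle.trans (hp.cons c), hA, ?_⟩
      simp only [List.mem_cons, forall_eq_or_imp]
      exact ⟨hc, hL⟩
    · push Not at hc
      refine ⟨c :: A, B, hp.cons c, ⟨?_, List.pairwise_cons.2 ⟨hc.2, hA.2⟩⟩, ?_⟩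
      · simp only [List.mem_cons, forall_eq_or_imp]
        exact ⟨hc.1, hA.1⟩
      · simp only [List.mem_cons, forall_eq_or_imp]
        refine ⟨fun _ ↦ ⟨c, Or.inl rfl, Or.inl ⟨rfl, rfl⟩⟩, fun d hd hne ↦ ?_⟩
        obtain ⟨a, ha, haj⟩ := hL d hd hne
        exact ⟨a, Or.inr ha, haj⟩

/-! ### Graphs and lists of arcs -/

open Classical in
/-- The degree in a multigraph as a sum over an enumeration of the edges. -/
lemma _root_.Graph.degree_eq_sum {α β ι : Type*} [Fintype ι] {G : Graph α β} {f : ι → β}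
    (hf : Function.Injective f) (hrange : Set.range f = G.edgeSet) {s t : ι → α}
    (hlink : ∀ i, G.IsLink (f i) (s i) (t i)) (v : α) :
    G.degree v = ((∑ i, ((if s i = v then 1 else 0) + (if t i = v then 1 else 0)) : ℕ) : ℕ∞) := by
  have h1 : G.incidenceSet v = f '' ↑(Finset.univ.filter fun i ↦ s i = v ∨ t i = v) := by
    ext e
    simp only [Graph.mem_incidenceSet, Finset.coe_filter, Finset.mem_univ, true_and, Set.mem_image,
      Set.mem_ofPred_eq]
    constructor
    · intro h
      obtain ⟨i, rfl⟩ := hrange.symm ▸ h.edge_mem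
      exact ⟨i, (h.eq_or_eq_of_isLink (hlink i)).imp Eq.symm Eq.symm, rfl⟩
    · rintro ⟨i, rfl | rfl, rfl⟩
      exacts [(hlink i).inc_left, (hlink i).inc_right]
  have h2 : G.loopSet v = f '' ↑(Finset.univ.filter fun i ↦ s i = v ∧ t i = v) := by
    ext e
    simp only [Graph.mem_loopSet, Finset.coe_filter, Finset.mem_univ, true_and, Set.mem_image,
      Set.mem_ofPred_eq]
    constructor
    · intro h
      obtain ⟨i, rfl⟩ := hrange.symm ▸ h.edge_mem
      exact ⟨i, ⟨(h.eq_of_inc (hlink i).inc_left).symm, (h.eq_of_inc (hlink i).inc_right).symm⟩,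
        rfl⟩
    · rintro ⟨i, ⟨h, h'⟩, rfl⟩
      have := hlink i
      rwa [h, h'] at this
  rw [Graph.degree, h1, h2, hf.encard_image, hf.encard_image, Set.encard_coe_eq_coe_finsetCard,
    Set.encard_coe_eq_coe_finsetCard, Finset.sum_add_distrib, ← Finset.card_filter,
    ← Finset.card_filter, Finset.filter_or, Finset.filter_and]
  exact_mod_cast Finset.card_union_add_card_inter _ _

/-- A planar multigraph, regular of degree four, on a finite vertex set gives a list of arcs. -/
lemma _root_.Graph.IsPlanar.exists_isDrawing {α β : Type*} [Finite α] {G : Graph α β}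
    (hp : G.IsPlanar) (hV : G.vertexSet = Set.univ) (hreg : G.IsRegularOfDegree 4) :
    ∃ p : α → EuclideanSpace ℝ (Fin 2), Function.Injective p ∧ ∃ L, IsDrawing (Set.range p) L ∧
      (∀ v, degree L (p v) = 4) ∧ ∀ u v, G.Adj u v → ∃ c ∈ L, c.Joins (p u) (p v) := by
  classical
  obtain ⟨p, γ, hd⟩ := hp
  have hinj : Function.Injective p := by
    have := hd.injOn_point
    rwa [hV, Set.injOn_univ] at this
  have hreg' : ∀ v, G.degree v = 4 := fun v ↦ hreg v (hV ▸ Set.mem_univ v)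
  have hfin : G.edgeSet.Finite := by
    refine (Set.finite_iUnion (f := G.incidenceSet) fun v ↦ ?_).subset fun e he ↦ ?_
    · refine Set.encard_ne_top_iff.1 fun htop ↦ ?_
      have := hreg' v
      rw [Graph.degree, htop, top_add] at this
      exact absurd this (by decide)
    · obtain ⟨x, y, h⟩ := Graph.exists_isLink_of_mem_edgeSet he
      exact Set.mem_iUnion.2 ⟨x, h.inc_left⟩
  have := hfin.fintype
  choose s t hlink h0 h1 using fun e : G.edgeSet ↦ hd.ends e e.2
  let arc : G.edgeSet → Arc (EuclideanSpace ℝ (Fin 2)) := fun e ↦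
    ⟨p (s e), p (t e), γ e '' Set.Ioo 0 1, h0 e ▸ h1 e ▸
      IsCurve.of_continuousOn (hd.continuousOn e e.2) (hd.injOn_curve e e.2)⟩
  refine ⟨p, hinj, (Finset.univ : Finset G.edgeSet).toList.map arc, ⟨?_, ?_, ?_, ?_⟩, ?_, ?_⟩
  · simp only [List.mem_map, forall_exists_index, and_imp, forall_apply_eq_imp_iff₂]
    exact fun e _ ↦ ⟨s e, rfl⟩
  · simp only [List.mem_map, forall_exists_index, and_imp, forall_apply_eq_imp_iff₂]
    exact fun e _ ↦ ⟨t e, rfl⟩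
  · simp only [List.mem_map, forall_exists_index, and_imp, forall_apply_eq_imp_iff₂]
    intro e _
    rw [Set.disjoint_left]
    rintro _ ⟨x, hx, rfl⟩ ⟨v, hv⟩
    exact hd.avoids_vertices e e.2 x hx v (hV ▸ Set.mem_univ v) hv.symm
  · rw [List.pairwise_map]
    refine (Finset.nodup_toList _).imp fun {e f} hef ↦ ?_
    rw [Set.disjoint_left]
    rintro _ ⟨x, hx, rfl⟩ ⟨y, hy, hxy⟩
    exact hd.avoids_edges e e.2 f f.2 (Subtype.coe_injective.ne hef) x hx y hy hxy.symm
  · intro v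
    have h4 := hreg' v
    rw [Graph.degree_eq_sum Subtype.coe_injective Subtype.range_coe hlink] at h4
    have h4' := Nat.cast_injective (R := ℕ∞) (h4.trans (Nat.cast_ofNat (n := 4)).symm)
    rw [degree, List.map_map, Finset.sum_map_toList, ← h4']
    exact Finset.sum_congr rfl fun e _ ↦ by simp [arc, hinj.eq_iff]
  · rintro u v ⟨e, he⟩
    refine ⟨arc ⟨e, he.edge_mem⟩, List.mem_map.2 ⟨_, by simp, rfl⟩, ?_⟩
    rcases (hlink ⟨e, he.edge_mem⟩).eq_and_eq_or_eq_and_eq he with ⟨h, h'⟩ | ⟨h, h'⟩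
    · exact Or.inl ⟨congrArg p h, congrArg p h'⟩
    · exact Or.inr ⟨congrArg p h, congrArg p h'⟩

/-- A list of arcs in which all vertices have degree four gives a planar multigraph. -/
lemma IsDrawing.exists_graph {α : Type u} {p : α → EuclideanSpace ℝ (Fin 2)}
    (hp : Function.Injective p) {L : List (Arc (EuclideanSpace ℝ (Fin 2)))}
    (h : IsDrawing (Set.range p) L) (hdeg : ∀ v, degree L (p v) = 4) :
    ∃ (β : Type u) (G : Graph α β), G.vertexSet = Set.univ ∧ G.IsPlanar ∧
      G.IsRegularOfDegree 4 ∧ ∀ u v, (∃ c ∈ L, c.Joins (p u) (p v)) → G.Adj u v := by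
  classical
  let arc : ULift.{u} (Fin L.length) → Arc (EuclideanSpace ℝ (Fin 2)) := fun i ↦ L.get i.down
  have hmem : ∀ i, arc i ∈ L := fun i ↦ L.get_mem i.down
  choose s hs using fun i ↦ h.src_mem _ (hmem i)
  choose t ht using fun i ↦ h.tgt_mem _ (hmem i)
  choose γ hγ h0 h1 hinj him using fun i ↦ (arc i).isCurve
  let G : Graph α (ULift.{u} (Fin L.length)) :=
    { vertexSet := Set.univ
      IsLink := fun i x y ↦ (s i = x ∧ t i = y) ∨ (s i = y ∧ t i = x)
      isLink_symm := fun _ _ ↦ ⟨fun _ _ ↦ Or.symm⟩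
      eq_or_eq_of_isLink_of_isLink := by grind
      left_mem_of_isLink := fun _ _ _ _ ↦ Set.mem_univ _ }
  have hlink : ∀ i, G.IsLink i (s i) (t i) := fun i ↦ Or.inl ⟨rfl, rfl⟩
  have hE : Set.range id = G.edgeSet := by
    rw [Set.range_id]
    exact (Set.eq_univ_of_forall fun i ↦ (hlink i).edge_mem).symm
  refine ⟨_, G, rfl, ⟨p, γ, hp.injOn, fun i _ ↦ (hγ i).continuousOn,
    fun i _ ↦ ⟨s i, t i, hlink i, (h0 i).trans (hs i).symm, (h1 i).trans (ht i).symm⟩,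
    fun i _ ↦ hinj i, ?_, ?_⟩, ?_, ?_⟩
  · intro i _ x hx v _ e
    exact Set.disjoint_left.1 (h.disjoint _ (hmem i)) (him i ▸ ⟨x, hx, e⟩) ⟨v, rfl⟩
  · intro i _ j _ hij x hx y hy e
    have hpw : Disjoint (arc i).inner (arc j).inner := by
      have hpw := List.pairwise_iff_get.1 h.pairwise
      have hne : i.down ≠ j.down := fun e ↦ hij (ULift.ext _ _ e)
      rcases lt_or_gt_of_ne hne with hlt | hlt
      · exact hpw _ _ hlt
      · exact (hpw _ _ hlt).symm
    exact Set.disjoint_left.1 hpw (him i ▸ Set.mem_image_of_mem _ hx)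
      (him j ▸ ⟨y, hy, e.symm⟩)
  · intro v _
    rw [Graph.degree_eq_sum Function.injective_id hE hlink, ← hdeg v, degree,
      ← Fin.sum_univ_fun_getElem, ← (Equiv.ulift.{u} (α := Fin L.length)).sum_comp]
    congr 1
    refine Finset.sum_congr rfl fun i _ ↦ ?_
    have hs' : L[(Equiv.ulift i).1].src = p (s i) := (hs i).symm
    have ht' : L[(Equiv.ulift i).1].tgt = p (t i) := (ht i).symm
    rw [hs', ht']
    simp only [hp.eq_iff]
  · rintro u v ⟨c, hc, hj⟩
    obtain ⟨i, rfl⟩ := List.get_of_mem hc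
    refine ⟨⟨i⟩, ?_⟩
    rcases hj with ⟨e, e'⟩ | ⟨e, e'⟩
    · exact Or.inl ⟨hp ((hs ⟨i⟩).trans e), hp ((ht ⟨i⟩).trans e')⟩
    · exact Or.inr ⟨hp ((hs ⟨i⟩).trans e), hp ((ht ⟨i⟩).trans e')⟩

lemma _root_.SimpleGraph.ofSimpleGraph_degree {W : Type*} (G : SimpleGraph W) (v : W)
    [Fintype (G.neighborSet v)] : (Graph.ofSimpleGraph G).degree v = G.degree v := by
  classical
  have h1 : (Graph.ofSimpleGraph G).incidenceSet v = G.incidenceSet v := by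
    ext e
    simp only [Graph.mem_incidenceSet, Graph.Inc, Graph.ofSimpleGraph_isLink,
      SimpleGraph.incidenceSet, Set.mem_ofPred_eq, Sym2.mem_iff_exists]
    constructor
    · rintro ⟨y, h, he⟩
      exact ⟨he, y, h⟩
    · rintro ⟨he, y, h⟩
      exact ⟨y, h, he⟩
  have h2 : (Graph.ofSimpleGraph G).loopSet v = ∅ := by
    ext e
    simp only [Graph.mem_loopSet, Graph.IsLoopAt, Graph.ofSimpleGraph_isLink,
      Set.mem_empty_iff_false, iff_false, not_and]
    rintro rfl
    simp
  rw [Graph.degree, h1, h2, Set.encard_empty, add_zero, ← G.card_incidenceSet_eq_degree,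
    Set.coe_fintypeCard]

/-- In a simple list of arcs the degree of a point is the number of its neighbours. -/
lemma IsSimple.exists_finset_neighbors {X : Type*} [TopologicalSpace X] {L : List (Arc X)}
    (hL : IsSimple L) (x : X) :
    ∃ S : Finset X, S.card = degree L x ∧ ∀ y, y ∈ S ↔ ∃ c ∈ L, c.Joins x y := by
  classical
  induction L with
  | nil => exact ⟨∅, rfl, by simp⟩
  | cons c L ih =>
    obtain ⟨hloop, hpar⟩ := hL
    simp only [List.mem_cons, forall_eq_or_imp] at hloop
    rw [List.pairwise_cons] at hpar
    obtain ⟨S, hS, hmem⟩ := ih ⟨hloop.2, hpar.2⟩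
    simp only [List.mem_cons, exists_eq_or_imp, ← hmem, degree_cons]
    by_cases hs : c.src = x
    · have ht : c.tgt ≠ x := fun e ↦ hloop.1 (hs.trans e.symm)
      refine ⟨insert c.tgt S, ?_, fun y ↦ ?_⟩
      · rw [Finset.card_insert_of_notMem, hS, if_pos hs, if_neg ht, add_comm]
        rw [hmem]
        rintro ⟨d, hd, hj⟩
        exact hpar.1 d hd (hs ▸ hj)
      · simp [Arc.Joins, hs, ht, eq_comm]
    · by_cases ht : c.tgt = x
      · refine ⟨insert c.src S, ?_, fun y ↦ ?_⟩
        · rw [Finset.card_insert_of_notMem, hS, if_neg hs, if_pos ht, add_comm]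
          rw [hmem]
          rintro ⟨d, hd, hj⟩
          exact hpar.1 d hd (ht ▸ hj.symm)
        · simp [Arc.Joins, hs, ht, eq_comm]
      · exact ⟨S, by simp [hS, hs, ht], fun y ↦ by simp [Arc.Joins, hs, ht]⟩

/-- A simple list of arcs in which all vertices have degree four gives a planar simple graph. -/
lemma IsDrawing.exists_simpleGraph {V : Set (EuclideanSpace ℝ (Fin 2))}
    {L : List (Arc (EuclideanSpace ℝ (Fin 2)))} (hfin : V.Finite) (h : IsDrawing V L)
    (hL : IsSimple L) (hdeg : ∀ v ∈ V, degree L v = 4) :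
    ∃ (G : SimpleGraph (ULift.{u} V)) (_ : G.LocallyFinite), G.IsPlanar ∧
      G.IsRegularOfDegree 4 ∧ ∀ x y, (∃ c ∈ L, c.Joins x.down y.down) → G.Adj x y := by
  classical
  have := hfin.fintype
  let p : ULift.{u} V → EuclideanSpace ℝ (Fin 2) := fun x ↦ x.down
  have hp : Function.Injective p := Subtype.val_injective.comp ULift.down_injective
  let G : SimpleGraph (ULift.{u} V) :=
    { Adj := fun x y ↦ ∃ c ∈ L, c.Joins (p x) (p y)
      symm := ⟨fun x y ⟨c, hc, hj⟩ ↦ ⟨c, hc, hj.symm⟩⟩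
      loopless := ⟨fun x ⟨c, hc, hj⟩ ↦ hL.1 c hc (by
        rcases hj with ⟨e, e'⟩ | ⟨e, e'⟩ <;> rw [e, e'])⟩ }
  refine ⟨G, fun _ ↦ Fintype.ofFinite _, ?_, ?_, fun x y h ↦ h⟩
  · have hcurve : ∀ e ∈ G.edgeSet, ∃ γ : ℝ → EuclideanSpace ℝ (Fin 2), ∃ c ∈ L, ∃ x y,
        e = s(x, y) ∧ c.src = p x ∧ c.tgt = p y ∧ Continuous γ ∧ γ 0 = p x ∧ γ 1 = p y ∧
          Set.InjOn γ (Set.Ioo 0 1) ∧ γ '' Set.Ioo 0 1 = c.inner := by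
      intro e
      induction e with | h x y => ?_
      rintro ⟨c, hc, hj⟩
      obtain ⟨γ, hγ, h0, h1, hinj, him⟩ := c.isCurve
      rcases hj with ⟨e, e'⟩ | ⟨e, e'⟩
      · exact ⟨γ, c, hc, x, y, rfl, e, e', hγ, h0.trans e, h1.trans e', hinj, him⟩
      · exact ⟨γ, c, hc, y, x, Sym2.eq_swap, e, e', hγ, h0.trans e, h1.trans e', hinj, him⟩
    choose! γ hγ using hcurve
    refine ⟨p, γ, hp.injOn, fun e he ↦ ?_, fun e he ↦ ?_, fun e he ↦ ?_, fun e he t ht v _ hv ↦ ?_,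
      fun e he f hf hef s hs t ht hst ↦ hef ?_⟩
    · obtain ⟨-, -, -, -, -, -, -, hcont, -⟩ := hγ e he
      exact hcont.continuousOn
    · obtain ⟨-, -, x, y, hxy, -, -, -, h0, h1, -⟩ := hγ e he
      exact ⟨x, y, ⟨hxy, he⟩, h0, h1⟩
    · obtain ⟨-, -, -, -, -, -, -, -, -, -, hinj, -⟩ := hγ e he
      exact hinj
    · obtain ⟨c, hc, x, y, -, -, -, -, -, -, -, him⟩ := hγ e he
      exact Set.disjoint_left.1 (h.disjoint c hc) (him ▸ ⟨t, ht, hv⟩) v.down.2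
    · obtain ⟨c, hc, x, y, rfl, hcs, hct, -, -, -, -, him⟩ := hγ e he
      obtain ⟨d, hd, x', y', rfl, hds, hdt, -, -, -, -, him'⟩ := hγ f hf
      have hcd : c = d := by
        by_contra hne
        have : Std.Symm fun c d : Arc (EuclideanSpace ℝ (Fin 2)) ↦ Disjoint c.inner d.inner :=
          ⟨fun _ _ h ↦ h.symm⟩
        exact Set.disjoint_left.1 (h.pairwise.forall hc hd hne) (him ▸ Set.mem_image_of_mem _ hs)
          (him' ▸ ⟨t, ht, hst.symm⟩)
      subst hcd
      rw [hp (hcs.symm.trans hds), hp (hct.symm.trans hdt)]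
  · intro v
    obtain ⟨S, hS, hmem⟩ := hL.exists_finset_neighbors (p v)
    rw [hdeg _ v.down.2] at hS
    rw [← hS, ← SimpleGraph.card_neighborFinset_eq_degree, ← Finset.card_image_of_injective _ hp]
    congr 1
    ext y
    rw [hmem, Finset.mem_image]
    simp only [SimpleGraph.mem_neighborFinset]
    constructor
    · rintro ⟨x, hx, rfl⟩
      exact hx
    · rintro ⟨c, hc, hj⟩
      have hy : y ∈ V := by
        rcases hj with ⟨-, e⟩ | ⟨e, -⟩
        exacts [e ▸ h.tgt_mem c hc, e ▸ h.src_mem c hc]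
      exact ⟨⟨y, hy⟩, ⟨c, hc, hj⟩, rfl⟩

end PlaneDrawing

theorem mainTheorem12 {V : Type u} [Fintype V] (H : SimpleGraph V) [DecidableRel H.Adj]
    (hplanar : H.IsPlanar) (hdeg : H.maxDegree ≤ 4) :
    (∃ (W : Type u) (_ : Fintype W) (G : SimpleGraph W) (_ : G.LocallyFinite),
        G.IsPlanar ∧ G.IsRegularOfDegree 4 ∧ H.IsContained G) ↔
      ∃ (E : Type u) (G' : Graph V E),
        G'.vertexSet = Set.univ ∧ G'.IsPlanar ∧ G'.IsRegularOfDegree 4 ∧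
          ∀ u v, H.Adj u v → G'.Adj u v := by
  constructor
  · rintro ⟨W, _, G, _, hG, hreg, ⟨f⟩⟩
    obtain ⟨p, hp, L, hL, hL4, hadj⟩ := Graph.IsPlanar.exists_isDrawing hG rfl fun v _ ↦ by
      rw [G.ofSimpleGraph_degree, hreg v]
    have hpf : Function.Injective (p ∘ f) := hp.comp f.injective
    have hrange : Set.range p \ Set.range (p ∘ f) ∪ Set.range (p ∘ f) = Set.range p :=
      Set.sdiff_union_of_subset (Set.range_comp_subset_range f p)
    obtain ⟨L', hL', hL'4, hkeep⟩ := PlaneDrawing.IsDrawing.remove_vertices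
      (T := Set.range p \ Set.range (p ∘ f)) (Set.finite_range (p ∘ f))
      (Set.finite_range p).sdiff Set.disjoint_sdiff_left (hrange.symm ▸ hL)
      (by rw [hrange]; rintro _ ⟨v, rfl⟩; exact hL4 v)
    obtain ⟨E, G', hV, hpl, hreg', hG'⟩ := hL'.exists_graph hpf fun v ↦ hL'4 _ ⟨v, rfl⟩
    refine ⟨E, G', hV, hpl, hreg', fun u v huv ↦ hG' u v ?_⟩
    obtain ⟨c, hc, hj⟩ := hadj (f u) (f v)
      ((Graph.ofSimpleGraph_adj_iff _ _).2 (f.toHom.map_adj huv))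
    refine ⟨c, hkeep c hc ?_ ?_, hj⟩
    · rcases hj with ⟨e, -⟩ | ⟨e, -⟩
      exacts [⟨u, e.symm⟩, ⟨v, e.symm⟩]
    · rcases hj with ⟨-, e⟩ | ⟨-, e⟩
      exacts [⟨v, e.symm⟩, ⟨u, e.symm⟩]
  · rintro ⟨E, G', hV, hpl, hreg, hH⟩
    obtain ⟨p, hp, L, hL, hL4, hadj⟩ := hpl.exists_isDrawing hV hreg
    obtain ⟨A, B, hperm, hA, hAL⟩ := PlaneDrawing.exists_perm_isSimple L
    obtain ⟨W, K, hVW, hW, hK, hKs, hK4, hAK⟩ := (hL.perm hperm.symm).exists_isSimple (by simp)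
      (Set.finite_range p) hA (by
        rintro _ ⟨v, rfl⟩
        rw [PlaneDrawing.degree_eq_of_perm hperm, hL4 v])
    obtain ⟨G, hlf, hG, hGreg, hGadj⟩ := hK.exists_simpleGraph hW hKs hK4
    have := hW.fintype
    refine ⟨ULift.{u} W, inferInstance, G, hlf, hG, hGreg,
      ⟨⟨⟨fun v ↦ ⟨⟨p v, hVW ⟨v, rfl⟩⟩⟩, ?_⟩, ?_⟩⟩⟩
    · intro u v huv
      refine hGadj _ _ ?_
      obtain ⟨c, hc, hj⟩ := hadj u v (hH u v huv)
      have huv' : p u ≠ p v := hp.ne huv.ne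
      rcases hj with ⟨e, e'⟩ | ⟨e, e'⟩
      · obtain ⟨a, ha, haj⟩ := hAL c hc (e ▸ e' ▸ huv')
        rw [e, e'] at haj
        exact ⟨a, hAK a ha, haj⟩
      · obtain ⟨a, ha, haj⟩ := hAL c hc (e ▸ e' ▸ huv'.symm)
        rw [e, e'] at haj
        exact ⟨a, hAK a ha, haj.symm⟩
    · intro u v huv
      exact hp (congrArg (fun x ↦ (x.down : EuclideanSpace ℝ (Fin 2))) huv)
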